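/- For $\alpha>0$ and $z\in\mathbb{H}=\{z\in\mathbb{C}:\operatorname{Im}z>0\}$ let $$\mathcal{K}(\alpha;z):=\sum_{(m,n)\in\mathbb{Z}^2}\frac{|mz+n|^2}{\operatorname{Im}(z)}\,e^{-\pi\alpha\frac{|mz+n|^2}{\operatorname{Im}(z)}},$$ and let $\Gamma_c:=\{z\in\mathbb{H}:\operatorname{Re}z=\tfrac12,\ \operatorname{Im}z\ge\tfrac{\sqrt3}{2}\}$. **Proposition 4.3.** Assume that $\alpha\ge 2$. Then the function $z\mapsto\mathcal{K}(\alpha;z)-2\,\mathcal{K}(2\alpha;z)$ attains its minimum over $\Gamma_c$ at the hexagonal point $e^{i\pi/3}=\tfrac12+i\tfrac{\sqrt3}{2}$ and at no other point of $\Gamma_c$, that is, $$\operatorname*{argmin}_{z\in\Gamma_c}\big(\mathcal{K}(\alpha;z)-2\,\mathcal{K}(2\alpha;z)\big)=\{e^{i\pi/3}\}.$$ -/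

import Mathlib

open UpperHalfPlane

noncomputable section

/-- The squared length `|m z + n|² / Im z` of the vector with coordinates `(m, n)` in the
unit-density lattice `(Im z)^(-1/2) (ℤ ⊕ z ℤ)`. -/
def latticeNormSq (z : ℍ) (p : ℤ × ℤ) : ℝ :=
  ‖(p.1 : ℂ) * (z : ℂ) + (p.2 : ℂ)‖ ^ 2 / z.im

/-- The lattice sum `𝒦(α; z) = ∑_{(m,n) ∈ ℤ²} (|m z + n|² / Im z) exp(-π α |m z + n|² / Im z)`.
It converges for every `α > 0`, see `summable_latticeK`. -/
def latticeK (α : ℝ) (z : ℍ) : ℝ :=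
  ∑' p : ℤ × ℤ, latticeNormSq z p * Real.exp (-Real.pi * α * latticeNormSq z p)

/-- The series defining `𝒦(α; z)` converges (so that the `tsum` is a genuine sum). -/
theorem summable_latticeK {α : ℝ} (hα : 0 < α) (z : ℍ) :
    Summable fun p : ℤ × ℤ =>
      latticeNormSq z p * Real.exp (-Real.pi * α * latticeNormSq z p) := by
  have hc : 0 < Real.pi * α := mul_pos Real.pi_pos hα
  have hz := z.im_pos
  have hs := ((summable_prod_eisSummand (k := 4) (by norm_num) z).norm).mul_left
    (6 / (Real.pi * α) ^ 3 * z.im ^ 2)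
  refine hs.of_nonneg_of_le (fun p => ?_) (fun p => ?_)
  · unfold latticeNormSq
    positivity
  · have hq : ‖EisensteinSeries.eisSummand ((4 : ℕ) : ℤ) ![p.1, p.2] z‖
        = (‖(p.1 : ℂ) * (z : ℂ) + (p.2 : ℂ)‖ ^ 4)⁻¹ := by
      simp only [EisensteinSeries.eisSummand, Matrix.cons_val_zero, Matrix.cons_val_one,
        zpow_neg, zpow_natCast, norm_inv, norm_pow]
    rw [hq]
    unfold latticeNormSq
    generalize ‖(p.1 : ℂ) * (z : ℂ) + (p.2 : ℂ)‖ = N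
    rcases eq_or_ne N 0 with h | h
    · simp [h]
    have hN : 0 < N ^ 2 / z.im := by positivity
    have hrhs : 6 / (Real.pi * α) ^ 3 * z.im ^ 2 * (N ^ 4)⁻¹
        = 6 / (Real.pi * α) ^ 3 / (N ^ 2 / z.im) ^ 2 := by
      field_simp
    rw [hrhs]
    generalize N ^ 2 / z.im = q at hN
    have hx : 0 ≤ Real.pi * α * q := by positivity
    have he := Real.pow_div_factorial_le_exp (Real.pi * α * q) hx 3
    rw [show -Real.pi * α * q = -(Real.pi * α * q) by ring, Real.exp_neg]
    have h6 : ((Nat.factorial 3 : ℕ) : ℝ) = 6 := by norm_num [Nat.factorial]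
    rw [h6] at he
    calc q * (Real.exp (Real.pi * α * q))⁻¹
        ≤ q * ((Real.pi * α * q) ^ 3 / 6)⁻¹ := by gcongr
      _ = 6 / (Real.pi * α) ^ 3 / q ^ 2 := by field_simp

/-- The closed vertical half-line `Γ_c = {z ∈ ℍ : Re z = 1/2, Im z ≥ √3/2}`. -/
def gammaC : Set ℍ := {z | z.re = 1 / 2 ∧ Real.sqrt 3 / 2 ≤ z.im}

/-- The hexagonal point `e^{iπ/3}`. -/
def hexPoint : ℍ :=
  ⟨Complex.exp (Complex.I * (Real.pi / 3)), by
    have h : Complex.I * (Real.pi / 3) = ((Real.pi / 3 : ℝ) : ℂ) * Complex.I := by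
      push_cast
      ring
    rw [h, Complex.exp_ofReal_mul_I_im, Real.sin_pi_div_three]
    positivity⟩

/-- The set of minimizers of `f` on `s`: the points of `s` at which `f` attains its minimum
over `s`. -/
def argminOn {X : Type*} (f : X → ℝ) (s : Set X) : Set X := {x | x ∈ s ∧ IsMinOn f s x}

end

/-!
Scaling by `u = 2πα/√3` and `r = 2 Im z/√3` turns the claim into: for `u ≥ 7`, the energy
`E(r) = ∑ φ(u Q_r(p))` with `φ(x) = x e⁻ˣ - 2x e⁻²ˣ` and
`Q_r(m, n) = (m/2 + n)²/r + (3/4) r m²` is larger at every `r > 1` than at `r = 1`, where `Q₁` is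
the norm form `N(m, n) = m² + mn + n²` and `E(1) ≤ 6.1 u e⁻ᵘ`.

* For `r ≤ 7/5`, all nonzero arguments lie in the region where `φ` is convex, so `φ` may be bounded
  below by its tangents at the points `u N(p)`. The order-six rotation preserves `N`, hence only the
  rotation average of `Q_r - N`, which is of order `(r - 1)²`, contributes to the sum of the tangent
  corrections. That loss is outweighed by the second-order gain at the two vectors `(0, ±1)`.
* For `r ≥ 7/5` and `u/r ≥ 1`, `φ` is nonnegative at all arguments and the vectors `(0, ±1)` alone
  contribute more than `E(1)`.
* For `u/r ≤ 1`, the row `m = 0` alone contributes more than `E(1)`: its sum is a combination of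
  derivatives of the theta function, which are controlled by difference quotients and Jacobi's
  inversion formula.
-/

open Real

section Calculus

lemma tangent_add_sq_le {D : Set ℝ} (hD : Convex ℝ D) {f f' f'' : ℝ → ℝ}
    (hf : ∀ x ∈ D, HasDerivAt f (f' x) x) (hf' : ∀ x ∈ D, HasDerivAt f' (f'' x) x) {K : ℝ}
    (hK : ∀ x ∈ D, K ≤ f'' x) {a x : ℝ} (ha : a ∈ D) (hx : x ∈ D) :
    f a + f' a * (x - a) + K / 2 * (x - a) ^ 2 ≤ f x := by
  have hg (x) (hx : x ∈ D) :
      HasDerivAt (fun x ↦ f x - K / 2 * (x - a) ^ 2) (f' x - K * (x - a)) x :=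
    ((hf x hx).sub ((((hasDerivAt_id x).sub_const a).pow 2).const_mul (K / 2))).congr_deriv
      (by simp only [id_eq]; ring)
  have hg' (x) (hx : x ∈ D) : HasDerivAt (fun x ↦ f' x - K * (x - a)) (f'' x - K) x :=
    ((hf' x hx).sub (((hasDerivAt_id x).sub_const a).const_mul K)).congr_deriv (by rw [mul_one])
  have hconv : ConvexOn ℝ D (fun x ↦ f x - K / 2 * (x - a) ^ 2) :=
    convexOn_of_hasDerivWithinAt2_nonneg hD
      (fun x hx ↦ (hg x hx).continuousAt.continuousWithinAt)
      (fun x hx ↦ (hg x (interior_subset hx)).hasDerivWithinAt)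
      (fun x hx ↦ (hg' x (interior_subset hx)).hasDerivWithinAt)
      (fun x hx ↦ sub_nonneg.2 (hK x (interior_subset hx)))
  have hga := hg a ha
  rcases lt_trichotomy x a with hxa | rfl | hax
  · have hslope := hconv.slope_le_of_hasDerivAt hx ha hxa hga
    rw [slope_def_field, div_le_iff₀ (by linarith)] at hslope
    linarith
  · simp
  · have hslope := hconv.le_slope_of_hasDerivAt ha hx hax hga
    rw [slope_def_field, le_div_iff₀ (by linarith)] at hslope
    linarith

lemma hasDerivAt_exp_neg_mul (k x : ℝ) :
    HasDerivAt (fun x ↦ rexp (-(k * x))) (-k * rexp (-(k * x))) x :=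
  ((hasDerivAt_id x).const_mul k).neg.exp.congr_deriv (by simp [mul_comm])

lemma exp_neg_le_pow {n : ℕ} {x : ℝ} (h : n ≤ x) : rexp (-x) ≤ 0.3679 ^ n := by
  calc rexp (-x) ≤ rexp (n * (-1)) := by gcongr; linarith
    _ = rexp (-1) ^ n := exp_nat_mul _ _
    _ ≤ 0.3679 ^ n := by gcongr; exact exp_neg_one_lt_d9.le.trans (by norm_num)

lemma exp_neg_two_mul (x : ℝ) : rexp (-(2 * x)) = rexp (-x) ^ 2 := by
  rw [← exp_nat_mul]; congr 1; push_cast; ring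

lemma exp_neg_mul_sub_exp_neg_mul_le (a b x : ℝ) :
    rexp (-(a * x)) - rexp (-(b * x)) ≤ (b - a) * (x * rexp (-(a * x))) := by
  have hsplit : rexp (-(b * x)) = rexp (-(a * x)) * rexp ((a - b) * x) := by
    rw [← exp_add]; congr 1; ring
  have htangent := mul_le_mul_of_nonneg_left (add_one_le_exp ((a - b) * x))
    (exp_pos (-(a * x))).le
  rw [hsplit]
  linarith

lemma antitoneOn_sub_mul_exp_neg (a : ℝ) :
    AntitoneOn (fun x ↦ (x - a) * rexp (-x)) (Set.Ici (a + 1)) := by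
  intro x hx y _ hxy
  have hx : a + 1 ≤ x := hx
  have hsplit : rexp (-x) = rexp (y - x) * rexp (-y) := by rw [← exp_add]; congr 1; ring
  have htangent := add_one_le_exp (y - x)
  change (y - a) * rexp (-y) ≤ (x - a) * rexp (-x)
  rw [hsplit, ← mul_assoc]
  gcongr
  nlinarith

lemma mul_exp_neg_le_mul_exp_neg {x y : ℝ} (hx : 1 ≤ x) (hxy : x ≤ y) :
    y * rexp (-y) ≤ x * rexp (-x) := by
  simpa using antitoneOn_sub_mul_exp_neg 0 (Set.mem_Ici.2 (by linarith))
    (Set.mem_Ici.2 (by linarith)) hxy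

lemma mul_exp_neg_le {u : ℝ} (hu : 7 ≤ u) : u * rexp (-u) ≤ 0.0064 := by
  have hexp := exp_neg_le_pow (n := 7) (x := 7) (by norm_num)
  have hanti := mul_exp_neg_le_mul_exp_neg (by norm_num) hu
  norm_num at hexp
  linarith

end Calculus

section Profile

/-- The potential `φ(x) = x e⁻ˣ - 2x e⁻²ˣ`: up to the factor `πα`, the difference
`𝒦(α; z) - 2 𝒦(2α; z)` is the sum of `φ(πα q)` over the squared lengths `q` of the lattice. -/
noncomputable def profile (x : ℝ) : ℝ := x * rexp (-x) - 2 * x * rexp (-(2 * x))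

/-- The first derivative of `profile`. -/
noncomputable def profileDeriv (x : ℝ) : ℝ :=
  (1 - x) * rexp (-x) - (2 - 4 * x) * rexp (-(2 * x))

/-- The second derivative of `profile`. -/
noncomputable def profileDeriv₂ (x : ℝ) : ℝ :=
  (x - 2) * rexp (-x) - (8 * x - 8) * rexp (-(2 * x))

lemma profile_zero : profile 0 = 0 := by simp [profile]

lemma profile_eq_mul (x : ℝ) : profile x = x * rexp (-x) * (1 - 2 * rexp (-x)) := by
  rw [profile, exp_neg_two_mul]; ring

lemma hasDerivAt_profile (x : ℝ) : HasDerivAt profile (profileDeriv x) x := by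
  have hexp : HasDerivAt (fun x ↦ rexp (-x)) (-rexp (-x)) x := by
    simpa using hasDerivAt_exp_neg_mul 1 x
  refine (((hasDerivAt_id x).mul hexp).sub
    (((hasDerivAt_id x).const_mul 2).mul (hasDerivAt_exp_neg_mul 2 x))).congr_deriv ?_
  simp only [profileDeriv, id_eq]
  ring

lemma hasDerivAt_profileDeriv (x : ℝ) : HasDerivAt profileDeriv (profileDeriv₂ x) x := by
  have hexp : HasDerivAt (fun x ↦ rexp (-x)) (-rexp (-x)) x := by
    simpa using hasDerivAt_exp_neg_mul 1 x
  refine ((((hasDerivAt_id x).const_sub 1).mul hexp).sub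
    ((((hasDerivAt_id x).const_mul 4).const_sub 2).mul
      (hasDerivAt_exp_neg_mul 2 x))).congr_deriv ?_
  simp only [profileDeriv₂, id_eq]
  ring

lemma profile_le {x : ℝ} (hx : 0 ≤ x) : profile x ≤ x * rexp (-x) :=
  sub_le_self _ (by positivity)

lemma profile_nonneg {x : ℝ} (hx : 1 ≤ x) : 0 ≤ profile x := by
  have hexp := exp_neg_le_pow (n := 1) (by simpa using hx)
  rw [profile_eq_mul]
  exact mul_nonneg (by positivity) (by linarith)

lemma abs_profileDeriv_le {x : ℝ} (hx : 5 ≤ x) : |profileDeriv x| ≤ x * rexp (-x) := by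
  have hexp : rexp (-x) ≤ 0.007 :=
    (exp_neg_le_pow (n := 5) (by simpa using hx)).trans (by norm_num)
  have hpos := exp_pos (-x)
  have hnonneg : 0 ≤ (4 * x - 2) * rexp (-x) := mul_nonneg (by linarith) hpos.le
  rw [profileDeriv, exp_neg_two_mul, abs_le]
  constructor <;> nlinarith

lemma le_profileDeriv₂ {x : ℝ} (hx : 5 ≤ x) :
    9 / 10 * ((x - 2) * rexp (-x)) ≤ profileDeriv₂ x := by
  have hexp : rexp (-x) ≤ 0.007 :=
    (exp_neg_le_pow (n := 5) (by simpa using hx)).trans (by norm_num)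
  have hpos := exp_pos (-x)
  have hsmall : (8 * x - 8) * rexp (-x) ≤ (8 * x - 8) * 0.007 := by gcongr; linarith
  rw [profileDeriv₂, exp_neg_two_mul]
  nlinarith

lemma profile_tangent_le {a x : ℝ} (ha : 5 ≤ a) (hx : 5 ≤ x) :
    profile a + profileDeriv a * (x - a) ≤ profile x := by
  have hconvex (y : ℝ) (hy : y ∈ Set.Ici 5) : 0 ≤ profileDeriv₂ y := by
    have hy : 5 ≤ y := hy
    refine le_trans ?_ (le_profileDeriv₂ hy)
    have : 0 ≤ y - 2 := by linarith
    positivity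
  have := tangent_add_sq_le (convex_Ici 5) (fun y _ ↦ hasDerivAt_profile y)
    (fun y _ ↦ hasDerivAt_profileDeriv y) hconvex ha hx
  linarith

lemma profile_tangent_add_sq_le {a x : ℝ} (hx : 5 ≤ x) (hxa : x ≤ a) :
    profile a + profileDeriv a * (x - a) + 9 / 20 * ((a - 2) * rexp (-a)) * (x - a) ^ 2
      ≤ profile x := by
  have hconvex (y : ℝ) (hy : y ∈ Set.Icc 5 a) :
      9 / 10 * ((a - 2) * rexp (-a)) ≤ profileDeriv₂ y := by
    refine le_trans ?_ (le_profileDeriv₂ hy.1)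
    gcongr 9 / 10 * ?_
    exact antitoneOn_sub_mul_exp_neg 2 (Set.mem_Ici.2 (by linarith [hy.1]))
      (Set.mem_Ici.2 (by linarith)) hy.2
  have := tangent_add_sq_le (convex_Icc 5 a) (fun y _ ↦ hasDerivAt_profile y)
    (fun y _ ↦ hasDerivAt_profileDeriv y) hconvex ⟨hx.trans hxa, le_rfl⟩ ⟨hx, hxa⟩
  linarith

lemma lt_profile_of_le_two {t : ℝ} (ht : 1 ≤ t) (ht2 : t ≤ 2) : 0.07 < profile t := by
  have hexp := exp_neg_le_pow (n := 1) (by simpa using ht)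
  have hexp2 : 0.135 ≤ rexp (-2) := by
    have := exp_neg_one_gt_d9
    rw [show (-2 : ℝ) = -(2 * 1) by norm_num, exp_neg_two_mul]
    nlinarith
  have hanti := mul_exp_neg_le_mul_exp_neg ht ht2
  rw [profile_eq_mul]
  calc (0.07 : ℝ) < 0.27 * (1 - 2 * 0.3679) := by norm_num
    _ ≤ t * rexp (-t) * (1 - 2 * rexp (-t)) := by gcongr <;> linarith

lemma lt_profile_of_two_le {u t : ℝ} (hu : 7 ≤ u) (ht : 2 ≤ t) (htu : t ≤ 5 / 7 * u) :
    3.05 * (u * rexp (-u)) < profile t := by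
  have hexp := exp_neg_le_pow (n := 2) (by simpa using ht)
  have hexp2 : 7.38 ≤ rexp (2 / 7 * u) := by
    have he := exp_one_gt_d9
    calc (7.38 : ℝ) ≤ rexp 1 ^ 2 := by nlinarith
      _ = rexp 2 := by rw [← exp_nat_mul]; norm_num
      _ ≤ rexp (2 / 7 * u) := exp_le_exp.2 (by linarith)
  have hpos : 0 < u * rexp (-u) := by positivity
  have hlower : 5.27 * (u * rexp (-u)) ≤ t * rexp (-t) := by
    calc 5.27 * (u * rexp (-u)) ≤ 5 / 7 * 7.38 * (u * rexp (-u)) := by gcongr; norm_num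
      _ ≤ 5 / 7 * rexp (2 / 7 * u) * (u * rexp (-u)) := by gcongr
      _ = 5 / 7 * u * (rexp (2 / 7 * u) * rexp (-u)) := by ring
      _ = 5 / 7 * u * rexp (-(5 / 7 * u)) := by rw [← exp_add]; congr 2; ring
      _ ≤ t * rexp (-t) := mul_exp_neg_le_mul_exp_neg (by linarith) htu
  rw [profile_eq_mul]
  calc 3.05 * (u * rexp (-u)) < 5.27 * (u * rexp (-u)) * (1 - 2 * 0.3679 ^ 2) := by
        norm_num; linarith
    _ ≤ t * rexp (-t) * (1 - 2 * rexp (-t)) := by gcongr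

lemma lt_profile {u t : ℝ} (hu : 7 ≤ u) (ht : 1 ≤ t) (htu : t ≤ 5 / 7 * u) :
    3.05 * (u * rexp (-u)) < profile t := by
  rcases le_total t 2 with ht2 | ht2
  · linarith [mul_exp_neg_le hu, lt_profile_of_le_two ht ht2]
  · exact lt_profile_of_two_le hu ht2 htu

end Profile

section Series

lemma hasSum_ite_mem {ι : Type*} [DecidableEq ι] (s : Finset ι) (c : ℝ) :
    HasSum (fun i ↦ if i ∈ s then c else 0) (s.card * c) := by
  have h : HasSum (fun i ↦ if i ∈ s then c else 0) (∑ i ∈ s, if i ∈ s then c else 0) :=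
    hasSum_sum_of_ne_finset_zero fun i hi ↦ if_neg hi
  rwa [Finset.sum_ite_mem, Finset.inter_self, Finset.sum_const, nsmul_eq_mul] at h

lemma hasSum_pow_natAbs {x : ℝ} (h0 : 0 ≤ x) (h1 : x < 1) :
    HasSum (fun n : ℤ ↦ x ^ n.natAbs) ((1 + x) / (1 - x)) := by
  have hgeom := hasSum_geometric_of_lt_one h0 h1
  have hneg (n : ℕ) : x ^ (-((n : ℤ) + 1)).natAbs = x * x ^ n := by
    rw [← pow_succ']
    congr 1
  rw [show (1 + x) / (1 - x) = (1 - x)⁻¹ + x * (1 - x)⁻¹ by rw [div_eq_mul_inv]; ring]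
  refine HasSum.of_nat_of_neg_add_one (by simpa using hgeom) ?_
  simpa only [hneg] using hgeom.mul_left x

lemma hasSum_pow_natAbs_add_natAbs {x : ℝ} (h0 : 0 ≤ x) (h1 : x < 1) :
    HasSum (fun p : ℤ × ℤ ↦ x ^ (p.1.natAbs + p.2.natAbs)) (((1 + x) / (1 - x)) ^ 2) := by
  have h := hasSum_pow_natAbs h0 h1
  have hmul := h.mul h
    (h.summable.mul_of_nonneg h.summable (fun n ↦ by positivity) (fun n ↦ by positivity))
  simpa only [pow_add, ← pow_two] using hmul

lemma natAbs_le_sq (k : ℤ) : (k.natAbs : ℝ) ≤ (k : ℝ) ^ 2 := by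
  rw [Nat.cast_natAbs, Int.cast_abs, ← sq_abs]
  exact_mod_cast Int.le_self_sq |k|

end Series

section HexagonalLattice

/-- The norm form `m² + mn + n²` of the hexagonal lattice. -/
def hexNorm (p : ℤ × ℤ) : ℝ := (p.1 : ℝ) ^ 2 + p.1 * p.2 + (p.2 : ℝ) ^ 2

/-- The six shortest vectors of the hexagonal lattice. -/
def hexUnits : Finset (ℤ × ℤ) := {(0, 1), (0, -1), (1, 0), (-1, 0), (1, -1), (-1, 1)}

/-- The rotation of order six of the hexagonal lattice. -/
def hexRotation : ℤ × ℤ ≃ ℤ × ℤ where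
  toFun p := (-p.2, p.1 + p.2)
  invFun p := (p.1 + p.2, -p.1)
  left_inv p := by ext <;> simp
  right_inv p := by ext <;> simp

lemma hexNorm_eq (p : ℤ × ℤ) :
    hexNorm p = ((p.1 : ℝ) / 2 + p.2) ^ 2 + 3 / 4 * (p.1 : ℝ) ^ 2 := by
  unfold hexNorm; ring

lemma hexNorm_zero : hexNorm 0 = 0 := by simp [hexNorm]

lemma hexNorm_nonneg (p : ℤ × ℤ) : 0 ≤ hexNorm p := by
  rw [hexNorm_eq]; positivity

lemma hexNorm_hexRotation (p : ℤ × ℤ) : hexNorm (hexRotation p) = hexNorm p := by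
  simp only [hexNorm, hexRotation, Equiv.coe_fn_mk, Int.cast_neg, Int.cast_add]
  ring

lemma natAbs_add_natAbs_le_two_mul_hexNorm (p : ℤ × ℤ) :
    ((p.1.natAbs + p.2.natAbs : ℕ) : ℝ) ≤ 2 * hexNorm p := by
  have h1 := natAbs_le_sq p.1
  have h2 := natAbs_le_sq p.2
  push_cast
  unfold hexNorm
  nlinarith [sq_nonneg ((p.1 : ℝ) + p.2)]

lemma hexNorm_of_mem_hexUnits {p : ℤ × ℤ} (hp : p ∈ hexUnits) : hexNorm p = 1 := by
  simp only [hexUnits, Finset.mem_insert, Finset.mem_singleton] at hp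
  rcases hp with rfl | rfl | rfl | rfl | rfl | rfl <;> norm_num [hexNorm]

lemma eq_zero_or_mem_hexUnits_or_three_le_hexNorm (p : ℤ × ℤ) :
    p = 0 ∨ p ∈ hexUnits ∨ 3 ≤ hexNorm p := by
  obtain ⟨m, n⟩ := p
  by_contra! h
  obtain ⟨hzero, hunits, hnorm⟩ := h
  have hnorm : m ^ 2 + m * n + n ^ 2 < 3 := by
    simp only [hexNorm] at hnorm; exact_mod_cast hnorm
  have hm : m ^ 2 < 2 ^ 2 := by nlinarith [sq_nonneg (m + 2 * n)]
  have hn : n ^ 2 < 2 ^ 2 := by nlinarith [sq_nonneg (n + 2 * m)]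
  obtain ⟨hm1, hm2⟩ := abs_lt.1 (abs_lt_of_sq_lt_sq hm (by norm_num))
  obtain ⟨hn1, hn2⟩ := abs_lt.1 (abs_lt_of_sq_lt_sq hn (by norm_num))
  interval_cases m <;> interval_cases n <;>
    first | omega | exact hzero rfl | exact hunits (by decide)

lemma one_le_hexNorm {p : ℤ × ℤ} (hp : p ≠ 0) : 1 ≤ hexNorm p := by
  rcases eq_zero_or_mem_hexUnits_or_three_le_hexNorm p with h | h | h
  · exact absurd h hp
  · exact (hexNorm_of_mem_hexUnits h).ge
  · linarith

/-- A summable function dominating `N(p)² e^{-u(N(p) - 1)}` for `u ≥ 7`, where `N` is `hexNorm`. -/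
noncomputable def hexMajorant (p : ℤ × ℤ) : ℝ :=
  (if p ∈ hexUnits then 1 else 0) + 2 * rexp (-5) * rexp (-1) ^ (p.1.natAbs + p.2.natAbs)

lemma hasSum_hexMajorant :
    HasSum hexMajorant (6 + 2 * rexp (-5) * ((1 + rexp (-1)) / (1 - rexp (-1))) ^ 2) := by
  have hunits := hasSum_ite_mem hexUnits 1
  rw [show hexUnits.card = 6 by decide] at hunits
  have hgeom := hasSum_pow_natAbs_add_natAbs (exp_pos (-1)).le (exp_lt_one_iff.2 (by norm_num))
  have hsum := hunits.add (hgeom.mul_left (2 * rexp (-5)))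
  rw [Nat.cast_ofNat, mul_one] at hsum
  exact hsum

lemma tsum_hexMajorant_le : ∑' p, hexMajorant p ≤ 6.1 := by
  have hexp1 := exp_neg_le_pow (n := 1) (x := 1) (by norm_num)
  have hexp5 := exp_neg_le_pow (n := 5) (x := 5) (by norm_num)
  norm_num at hexp1 hexp5
  have hquot : (1 + rexp (-1)) / (1 - rexp (-1)) ≤ 2.2 := by
    rw [div_le_iff₀ (by linarith)]
    linarith
  have hquot0 : 0 ≤ (1 + rexp (-1)) / (1 - rexp (-1)) :=
    div_nonneg (by positivity) (by linarith)
  rw [hasSum_hexMajorant.tsum_eq]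
  calc _ ≤ 6 + 2 * 0.007 * (2.2 : ℝ) ^ 2 := by gcongr; linarith
    _ ≤ 6.1 := by norm_num

lemma sq_hexNorm_mul_exp_le {u : ℝ} (hu : 7 ≤ u) (p : ℤ × ℤ) :
    hexNorm p ^ 2 * rexp (-(u * hexNorm p)) ≤ rexp (-u) * hexMajorant p := by
  rcases eq_zero_or_mem_hexUnits_or_three_le_hexNorm p with rfl | hp | hp
  · rw [hexNorm_zero, hexMajorant, if_neg (by decide), zero_pow two_ne_zero, zero_mul]
    positivity
  · rw [hexNorm_of_mem_hexUnits hp, hexMajorant, if_pos hp, one_pow, one_mul, mul_one]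
    exact le_mul_of_one_le_right (exp_pos _).le (le_add_of_nonneg_right (by positivity))
  · set k := p.1.natAbs + p.2.natAbs
    have hk : (k : ℝ) ≤ 2 * hexNorm p := natAbs_add_natAbs_le_two_mul_hexNorm p
    have hsq : hexNorm p ^ 2 ≤ 2 * rexp (hexNorm p) := by
      have := pow_div_factorial_le_exp (hexNorm p) (hexNorm_nonneg p) 2
      rw [Nat.factorial_two, div_le_iff₀ (by norm_num)] at this
      push_cast at this
      linarith
    calc hexNorm p ^ 2 * rexp (-(u * hexNorm p))
        ≤ 2 * rexp (hexNorm p) * rexp (-(u * hexNorm p)) := by gcongr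
      _ = 2 * rexp (hexNorm p - u * hexNorm p) := by rw [sub_eq_add_neg, exp_add]; ring
      _ ≤ 2 * rexp (-u + -5 + k * (-1)) := by gcongr; nlinarith
      _ = rexp (-u) * (2 * rexp (-5) * rexp (-1) ^ k) := by
        rw [exp_add, exp_add, exp_nat_mul]; ring
      _ ≤ rexp (-u) * hexMajorant p := by
        unfold hexMajorant
        gcongr
        exact le_add_of_nonneg_left (by split_ifs <;> norm_num)

lemma summable_sq_hexNorm_mul_exp {u : ℝ} (hu : 7 ≤ u) :
    Summable fun p ↦ hexNorm p ^ 2 * rexp (-(u * hexNorm p)) :=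
  (hasSum_hexMajorant.summable.mul_left _).of_nonneg_of_le (fun p ↦ by positivity)
    (sq_hexNorm_mul_exp_le hu)

lemma tsum_sq_hexNorm_mul_exp_le {u : ℝ} (hu : 7 ≤ u) :
    ∑' p, hexNorm p ^ 2 * rexp (-(u * hexNorm p)) ≤ 6.1 * rexp (-u) := by
  calc _ ≤ ∑' p, rexp (-u) * hexMajorant p :=
        (summable_sq_hexNorm_mul_exp hu).tsum_le_tsum (sq_hexNorm_mul_exp_le hu)
          (hasSum_hexMajorant.summable.mul_left _)
    _ = rexp (-u) * ∑' p, hexMajorant p := tsum_mul_left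
    _ ≤ rexp (-u) * 6.1 := by gcongr; exact tsum_hexMajorant_le
    _ = 6.1 * rexp (-u) := mul_comm _ _

lemma abs_profileDeriv_mul_le {u C x : ℝ} (hu : 5 ≤ u) (p : ℤ × ℤ) (hx : |x| ≤ C * hexNorm p) :
    |profileDeriv (u * hexNorm p) * x| ≤ u * C * (hexNorm p ^ 2 * rexp (-(u * hexNorm p))) := by
  rcases eq_or_ne p 0 with rfl | hp
  · rw [hexNorm_zero, mul_zero, abs_nonpos_iff] at hx
    simp [hx, hexNorm_zero]
  · have hN := one_le_hexNorm hp
    rw [abs_mul]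
    calc _ ≤ u * hexNorm p * rexp (-(u * hexNorm p)) * (C * hexNorm p) := by
          gcongr
          exact abs_profileDeriv_le (by nlinarith)
      _ = _ := by ring

lemma summable_profileDeriv_mul {u C : ℝ} (hu : 7 ≤ u) {X : ℤ × ℤ → ℝ}
    (hX : ∀ p, |X p| ≤ C * hexNorm p) :
    Summable fun p ↦ profileDeriv (u * hexNorm p) * X p :=
  ((summable_sq_hexNorm_mul_exp hu).mul_left (u * C)).of_norm_bounded
    fun p ↦ abs_profileDeriv_mul_le (by linarith) p (hX p)

lemma le_tsum_profileDeriv_mul_hexNorm {u : ℝ} (hu : 7 ≤ u) :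
    -(6.1 * (u * rexp (-u))) ≤ ∑' p, profileDeriv (u * hexNorm p) * hexNorm p := by
  have hle (p : ℤ × ℤ) : |hexNorm p| ≤ 1 * hexNorm p := by
    rw [abs_of_nonneg (hexNorm_nonneg p), one_mul]
  calc -(6.1 * (u * rexp (-u))) = -u * (6.1 * rexp (-u)) := by ring
    _ ≤ -u * ∑' p, hexNorm p ^ 2 * rexp (-(u * hexNorm p)) :=
      mul_le_mul_of_nonpos_left (tsum_sq_hexNorm_mul_exp_le hu) (by linarith)
    _ = ∑' p, -u * (hexNorm p ^ 2 * rexp (-(u * hexNorm p))) := tsum_mul_left.symm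
    _ ≤ ∑' p, profileDeriv (u * hexNorm p) * hexNorm p := by
      refine ((summable_sq_hexNorm_mul_exp hu).mul_left (-u)).tsum_le_tsum (fun p ↦ ?_)
        (summable_profileDeriv_mul hu hle)
      have := neg_le_of_abs_le (abs_profileDeriv_mul_le (by linarith : 5 ≤ u) p (hle p))
      linarith

end HexagonalLattice

section StretchedForm

/-- The form `latticeNormSq` at the point `1/2 + i (√3/2) r`, scaled by `√3/2` so that `r = 1`
gives `hexNorm`. -/
noncomputable def stretchedForm (r : ℝ) (p : ℤ × ℤ) : ℝ :=
  ((p.1 : ℝ) / 2 + p.2) ^ 2 / r + 3 / 4 * r * (p.1 : ℝ) ^ 2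

/-- The two shortest vectors of the stretched lattice when `r > 1`. -/
def axisUnits : Finset (ℤ × ℤ) := {(0, 1), (0, -1)}

variable {r : ℝ} {p : ℤ × ℤ}

lemma stretchedForm_one (p : ℤ × ℤ) : stretchedForm 1 p = hexNorm p := by
  rw [stretchedForm, hexNorm_eq]; ring

lemma stretchedForm_zero (r : ℝ) : stretchedForm r 0 = 0 := by simp [stretchedForm]

lemma stretchedForm_zero_left (r : ℝ) (n : ℤ) : stretchedForm r (0, n) = (n : ℝ) ^ 2 / r := by
  simp [stretchedForm]

lemma stretchedForm_of_mem_axisUnits (hp : p ∈ axisUnits) : stretchedForm r p = 1 / r := by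
  simp only [axisUnits, Finset.mem_insert, Finset.mem_singleton] at hp
  rcases hp with rfl | rfl <;> simp [stretchedForm_zero_left]

lemma hexNorm_of_mem_axisUnits (hp : p ∈ axisUnits) : hexNorm p = 1 := by
  rw [← stretchedForm_one, stretchedForm_of_mem_axisUnits hp, div_one]

lemma hexNorm_div_le_stretchedForm (hr : 1 ≤ r) (p : ℤ × ℤ) :
    hexNorm p / r ≤ stretchedForm r p := by
  have hinv : 1 / r ≤ r := (div_le_self zero_le_one hr).trans hr
  rw [hexNorm_eq, stretchedForm, add_div]
  gcongr
  calc 3 / 4 * (p.1 : ℝ) ^ 2 / r = 3 / 4 * (1 / r) * (p.1 : ℝ) ^ 2 := by ring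
    _ ≤ 3 / 4 * r * (p.1 : ℝ) ^ 2 := by gcongr

lemma stretchedForm_le_mul_hexNorm (hr : 1 ≤ r) (p : ℤ × ℤ) :
    stretchedForm r p ≤ r * hexNorm p := by
  rw [hexNorm_eq, stretchedForm, mul_add, ← mul_assoc, mul_comm r (3 / 4)]
  gcongr
  exact (div_le_self (sq_nonneg _) hr).trans (le_mul_of_one_le_left (sq_nonneg _) hr)

lemma abs_stretchedForm_sub_hexNorm_le (hr : 1 ≤ r) (p : ℤ × ℤ) :
    |stretchedForm r p - hexNorm p| ≤ r * hexNorm p := by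
  have hN := hexNorm_nonneg p
  have hupper := stretchedForm_le_mul_hexNorm hr p
  have hlower := hexNorm_div_le_stretchedForm hr p
  have hdiv : 0 ≤ hexNorm p / r := by positivity
  have hmul : hexNorm p ≤ r * hexNorm p := le_mul_of_one_le_left hN hr
  rw [abs_le]
  constructor <;> linarith

lemma div_le_mul_stretchedForm {u : ℝ} (hu : 0 ≤ u) (hr : 1 ≤ r) (hp : p ≠ 0) :
    u / r ≤ u * stretchedForm r p := by
  calc u / r = u * (1 / r) := (mul_one_div u r).symm
    _ ≤ u * (hexNorm p / r) := by gcongr; exact one_le_hexNorm hp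
    _ ≤ u * stretchedForm r p := by gcongr; exact hexNorm_div_le_stretchedForm hr p

lemma stretchedForm_add_rotations_sub (hr : r ≠ 0) (p : ℤ × ℤ) :
    stretchedForm r p + stretchedForm r (hexRotation p)
        + stretchedForm r (hexRotation (hexRotation p)) - 3 * hexNorm p
      = 3 * ((r - 1) ^ 2 / (2 * r)) * hexNorm p := by
  simp only [stretchedForm, hexNorm, hexRotation, Equiv.coe_fn_mk, Int.cast_neg, Int.cast_add]
  field_simp
  ring

lemma tsum_mul_stretchedForm_sub_hexNorm (hr : r ≠ 0) {w : ℤ × ℤ → ℝ}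
    (hw : ∀ p, w (hexRotation p) = w p)
    (hs : Summable fun p ↦ w p * (stretchedForm r p - hexNorm p)) :
    ∑' p, w p * (stretchedForm r p - hexNorm p)
      = (r - 1) ^ 2 / (2 * r) * ∑' p, w p * hexNorm p := by
  set X : ℤ × ℤ → ℝ := fun p ↦ w p * (stretchedForm r p - hexNorm p) with hX
  have h0 : HasSum X (∑' p, X p) := hs.hasSum
  have h1 : HasSum (X ∘ hexRotation) (∑' p, X p) := hexRotation.hasSum_iff.2 h0
  have h2 : HasSum ((X ∘ hexRotation) ∘ hexRotation) (∑' p, X p) := hexRotation.hasSum_iff.2 h1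
  have havg (p : ℤ × ℤ) : 1 / 3 * (X p + X (hexRotation p) + X (hexRotation (hexRotation p)))
      = (r - 1) ^ 2 / (2 * r) * (w p * hexNorm p) := by
    simp only [hX, hw, hexNorm_hexRotation]
    linear_combination (1 / 3 * w p) * stretchedForm_add_rotations_sub hr p
  calc ∑' p, X p = 1 / 3 * (∑' p, X p + ∑' p, X p + ∑' p, X p) := by ring
    _ = ∑' p, (r - 1) ^ 2 / (2 * r) * (w p * hexNorm p) := by
      rw [← (((h0.add h1).add h2).mul_left (1 / 3)).tsum_eq]
      exact tsum_congr havg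
    _ = _ := tsum_mul_left

end StretchedForm

section Energy

/-- The energy of the stretched lattice at inverse temperature `u`. It equals
`πα (𝒦(α; z) - 2 𝒦(2α; z))` for `z = 1/2 + i (√3/2) r` and `u = 2πα/√3`. -/
noncomputable def stretchedEnergy (u r : ℝ) : ℝ := ∑' p : ℤ × ℤ, profile (u * stretchedForm r p)

lemma latticeNormSq_eq {z : ℍ} (hz : z.re = 1 / 2) (p : ℤ × ℤ) :
    latticeNormSq z p = 2 / √3 * stretchedForm (2 / √3 * z.im) p := by
  have him := z.im_ne_zero
  have hre : ((p.1 : ℂ) * z + p.2).re = p.1 / 2 + p.2 := by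
    simp [hz]; ring
  have him' : ((p.1 : ℂ) * z + p.2).im = p.1 * z.im := by simp
  rw [latticeNormSq, stretchedForm, ← Complex.normSq_eq_norm_sq, Complex.normSq_apply, hre, him']
  field_simp
  rw [sq_sqrt (by norm_num)]
  ring

lemma profile_pi_mul (α q : ℝ) : profile (π * α * q)
    = π * α * (q * rexp (-π * α * q) - 2 * (q * rexp (-π * (2 * α) * q))) := by
  unfold profile
  rw [show -(π * α * q) = -π * α * q by ring,
    show -(2 * (π * α * q)) = -π * (2 * α) * q by ring]
  ring

lemma hasSum_profile_stretchedForm {α : ℝ} (hα : 0 < α) {z : ℍ} (hz : z.re = 1 / 2) :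
    HasSum (fun p ↦ profile (2 / √3 * (π * α) * stretchedForm (2 / √3 * z.im) p))
      (π * α * (latticeK α z - 2 * latticeK (2 * α) z)) := by
  have hterm (p : ℤ × ℤ) : 2 / √3 * (π * α) * stretchedForm (2 / √3 * z.im) p
      = π * α * latticeNormSq z p := by
    rw [latticeNormSq_eq hz]; ring
  simp only [hterm, profile_pi_mul]
  exact ((summable_latticeK hα z).hasSum.sub
    ((summable_latticeK (mul_pos two_pos hα) z).hasSum.mul_left 2)).mul_left _

lemma stretchedEnergy_eq {α : ℝ} (hα : 0 < α) {z : ℍ} (hz : z.re = 1 / 2) :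
    stretchedEnergy (2 / √3 * (π * α)) (2 / √3 * z.im)
      = π * α * (latticeK α z - 2 * latticeK (2 * α) z) :=
  (hasSum_profile_stretchedForm hα hz).tsum_eq

variable {u r : ℝ}

lemma summable_profile_stretchedForm (hu : 0 < u) (hr : 0 < r) :
    Summable fun p ↦ profile (u * stretchedForm r p) := by
  have hz : (⟨⟨1 / 2, √3 / 2 * r⟩, by positivity⟩ : ℍ).re = 1 / 2 := rfl
  have hsum := hasSum_profile_stretchedForm (by positivity : 0 < √3 / 2 * u / π) hz
  have him : 2 / √3 * (√3 / 2 * r) = r := by field_simp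
  have hα : 2 / √3 * (π * (√3 / 2 * u / π)) = u := by field_simp
  rw [← coe_im, him, hα] at hsum
  exact hsum.summable

lemma stretchedEnergy_one_le (hu : 7 ≤ u) : stretchedEnergy u 1 ≤ 6.1 * (u * rexp (-u)) := by
  have hterm (p : ℤ × ℤ) : profile (u * stretchedForm 1 p)
      ≤ u * (hexNorm p ^ 2 * rexp (-(u * hexNorm p))) := by
    have hN := hexNorm_nonneg p
    have hsq : hexNorm p ≤ hexNorm p ^ 2 := by
      rcases eq_or_ne p 0 with rfl | hp
      · simp [hexNorm_zero]
      · exact le_self_pow₀ (one_le_hexNorm hp) two_ne_zero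
    rw [stretchedForm_one]
    calc _ ≤ u * hexNorm p * rexp (-(u * hexNorm p)) := profile_le (by positivity)
      _ ≤ u * hexNorm p ^ 2 * rexp (-(u * hexNorm p)) := by gcongr
      _ = _ := mul_assoc _ _ _
  calc stretchedEnergy u 1 ≤ ∑' p, u * (hexNorm p ^ 2 * rexp (-(u * hexNorm p))) :=
        (summable_profile_stretchedForm (by linarith) one_pos).tsum_le_tsum hterm
          ((summable_sq_hexNorm_mul_exp hu).mul_left u)
    _ = u * ∑' p, hexNorm p ^ 2 * rexp (-(u * hexNorm p)) := tsum_mul_left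
    _ ≤ u * (6.1 * rexp (-u)) := by gcongr; exact tsum_sq_hexNorm_mul_exp_le hu
    _ = _ := by ring

end Energy

section ModerateStretch

variable {u r : ℝ}

lemma tangent_le_profile_stretchedForm (hu : 0 ≤ u) (hr : 1 ≤ r) (hur : 5 ≤ u / r)
    (p : ℤ × ℤ) :
    profile (u * stretchedForm 1 p)
        + u * (profileDeriv (u * hexNorm p) * (stretchedForm r p - hexNorm p))
        + (if p ∈ axisUnits then 9 / 20 * ((u - 2) * rexp (-u)) * (u / r - u) ^ 2 else 0)
      ≤ profile (u * stretchedForm r p) := by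
  have hu5 : 5 ≤ u := hur.trans (div_le_self hu hr)
  rw [stretchedForm_one]
  by_cases hp : p ∈ axisUnits
  · have := profile_tangent_add_sq_le hur (div_le_self (by linarith) hr)
    rw [if_pos hp, hexNorm_of_mem_axisUnits hp, stretchedForm_of_mem_axisUnits hp, mul_one,
      mul_one_div]
    linear_combination this
  rcases eq_or_ne p 0 with rfl | h0
  · simp [hp, hexNorm_zero, stretchedForm_zero]
  · have := profile_tangent_le (a := u * hexNorm p) (by nlinarith [one_le_hexNorm h0])
      (hur.trans (div_le_mul_stretchedForm (by linarith) hr h0))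
    rw [if_neg hp]
    linear_combination this

lemma le_stretchedEnergy_of_le_div (hu : 7 ≤ u) (hr : 1 ≤ r) (hur : 5 ≤ u / r) :
    stretchedEnergy u 1
        + u * ((r - 1) ^ 2 / (2 * r) * ∑' p, profileDeriv (u * hexNorm p) * hexNorm p)
        + 2 * (9 / 20 * ((u - 2) * rexp (-u)) * (u / r - u) ^ 2)
      ≤ stretchedEnergy u r := by
  have hr0 : 0 < r := by linarith
  have hs1 := summable_profile_stretchedForm (by linarith : 0 < u) one_pos
  have hsr := summable_profile_stretchedForm (by linarith : 0 < u) hr0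
  have hlin := summable_profileDeriv_mul hu (abs_stretchedForm_sub_hexNorm_le hr)
  have hgain := hasSum_ite_mem axisUnits (9 / 20 * ((u - 2) * rexp (-u)) * (u / r - u) ^ 2)
  have hrot := tsum_mul_stretchedForm_sub_hexNorm hr0.ne'
    (w := fun p ↦ profileDeriv (u * hexNorm p)) (fun p ↦ by rw [hexNorm_hexRotation]) hlin
  have hsum := hasSum_le (tangent_le_profile_stretchedForm (by linarith) hr hur)
    ((hs1.hasSum.add (hlin.hasSum.mul_left u)).add hgain) hsr.hasSum
  rw [hrot, show axisUnits.card = 2 by decide] at hsum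
  exact_mod_cast hsum

lemma stretchedEnergy_one_lt_of_le (hu : 7 ≤ u) (hr : 1 < r) (hr' : r ≤ 7 / 5) :
    stretchedEnergy u 1 < stretchedEnergy u r := by
  have hr0 : 0 < r := by linarith
  have hur : 5 ≤ u / r := by rw [le_div_iff₀ hr0]; linarith
  have hpos : 0 < (r - 1) ^ 2 / r * u * (u * rexp (-u)) := by
    have : 0 < r - 1 := by linarith
    positivity
  have hgain : 3.05 < 9 / 10 * (u - 2) / r := by rw [lt_div_iff₀ hr0]; linarith
  refine lt_of_lt_of_le ?_ (le_stretchedEnergy_of_le_div hu hr.le hur)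
  rw [add_assoc, lt_add_iff_pos_right]
  calc 0 < (r - 1) ^ 2 / r * u * (u * rexp (-u)) * (9 / 10 * (u - 2) / r - 3.05) :=
        mul_pos hpos (sub_pos.2 hgain)
    _ = u * ((r - 1) ^ 2 / (2 * r) * -(6.1 * (u * rexp (-u))))
          + 2 * (9 / 20 * ((u - 2) * rexp (-u)) * (u / r - u) ^ 2) := by
      field_simp
      ring
    _ ≤ _ := by
      gcongr
      exact le_tsum_profileDeriv_mul_hexNorm hu

end ModerateStretch

section LargeStretch

variable {u r : ℝ}

lemma profile_mul_stretchedForm_nonneg (hu : 0 ≤ u) (hr : 1 ≤ r) (hur : 1 ≤ u / r)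
    (p : ℤ × ℤ) : 0 ≤ profile (u * stretchedForm r p) := by
  rcases eq_or_ne p 0 with rfl | hp
  · rw [stretchedForm_zero, mul_zero, profile_zero]
  · exact profile_nonneg (hur.trans (div_le_mul_stretchedForm hu hr hp))

lemma two_mul_profile_div_le_stretchedEnergy (hu : 0 < u) (hr : 1 ≤ r) (hur : 1 ≤ u / r) :
    2 * profile (u / r) ≤ stretchedEnergy u r := by
  have hterm (p) (hp : p ∈ axisUnits) : profile (u * stretchedForm r p) = profile (u / r) := by
    rw [stretchedForm_of_mem_axisUnits hp, mul_one_div]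
  calc 2 * profile (u / r) = ∑ p ∈ axisUnits, profile (u * stretchedForm r p) := by
        rw [Finset.sum_congr rfl hterm, Finset.sum_const, show axisUnits.card = 2 by decide,
          nsmul_eq_mul, Nat.cast_ofNat]
    _ ≤ stretchedEnergy u r :=
      (summable_profile_stretchedForm hu (by linarith)).sum_le_tsum _
        fun p _ ↦ profile_mul_stretchedForm_nonneg hu.le hr hur p

lemma stretchedEnergy_one_lt_of_one_le_div (hu : 7 ≤ u) (hr : 7 / 5 ≤ r) (hur : 1 ≤ u / r) :
    stretchedEnergy u 1 < stretchedEnergy u r := by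
  have htu : u / r ≤ 5 / 7 * u := by
    rw [div_le_iff₀ (by linarith)]
    nlinarith
  calc stretchedEnergy u 1 ≤ 2 * (3.05 * (u * rexp (-u))) := by
        linarith [stretchedEnergy_one_le hu]
    _ < 2 * profile (u / r) := by gcongr; exact lt_profile hu hur htu
    _ ≤ stretchedEnergy u r :=
      two_mul_profile_div_le_stretchedEnergy (by linarith) (by linarith) hur

end LargeStretch

section Theta

/-- The Gaussian theta function `∑ exp(-s n²)`, normalized without the usual factor `π`. -/
noncomputable def gaussTheta (s : ℝ) : ℝ := ∑' n : ℤ, rexp (-(s * (n : ℝ) ^ 2))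

variable {s : ℝ}

lemma exp_neg_mul_sq_le_pow_natAbs (hs : 0 ≤ s) (n : ℤ) :
    rexp (-(s * (n : ℝ) ^ 2)) ≤ rexp (-s) ^ n.natAbs := by
  rw [← exp_nat_mul, exp_le_exp]
  nlinarith [natAbs_le_sq n]

lemma summable_exp_neg_mul_sq (hs : 0 < s) : Summable fun n : ℤ ↦ rexp (-(s * (n : ℝ) ^ 2)) :=
  (hasSum_pow_natAbs (exp_pos _).le (exp_lt_one_iff.2 (neg_lt_zero.2 hs))).summable.of_nonneg_of_le
    (fun _ ↦ (exp_pos _).le) (exp_neg_mul_sq_le_pow_natAbs hs.le)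

lemma one_le_gaussTheta (hs : 0 < s) : 1 ≤ gaussTheta s := by
  simpa [gaussTheta] using
    (summable_exp_neg_mul_sq hs).sum_le_tsum {0} fun _ _ ↦ (exp_pos _).le

lemma gaussTheta_le (hs : 0 < s) : gaussTheta s ≤ (1 + rexp (-s)) / (1 - rexp (-s)) := by
  have hgeom := hasSum_pow_natAbs (exp_pos (-s)).le (exp_lt_one_iff.2 (neg_lt_zero.2 hs))
  exact hasSum_le (exp_neg_mul_sq_le_pow_natAbs hs.le) (summable_exp_neg_mul_sq hs).hasSum hgeom

lemma gaussTheta_inversion (hs : 0 < s) :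
    gaussTheta s = √(π / s) * gaussTheta (π ^ 2 / s) := by
  have hexponent (n : ℤ) : -π * (s / π) * (n : ℝ) ^ 2 = -(s * (n : ℝ) ^ 2) := by field_simp
  have hexponent' (n : ℤ) : -π / (s / π) * (n : ℝ) ^ 2 = -(π ^ 2 / s * (n : ℝ) ^ 2) := by
    field_simp
  have hpoisson := tsum_exp_neg_mul_int_sq (div_pos hs pi_pos)
  simp only [hexponent, hexponent'] at hpoisson
  rw [gaussTheta, hpoisson, ← sqrt_eq_rpow, one_div, ← sqrt_inv, inv_div, gaussTheta]

lemma sqrt_pi_div_le_gaussTheta (hs : 0 < s) : √(π / s) ≤ gaussTheta s := by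
  rw [gaussTheta_inversion hs]
  exact le_mul_of_one_le_right (sqrt_nonneg _) (one_le_gaussTheta (by positivity))

lemma gaussTheta_le_sqrt_pi_div_mul {q : ℝ} (hs : 0 < s) (hq : rexp (-(π ^ 2 / s)) ≤ q)
    (hq1 : q < 1) : gaussTheta s ≤ √(π / s) * ((1 + q) / (1 - q)) := by
  have hq0 : 0 ≤ q := (exp_pos _).le.trans hq
  have : 0 < 1 - q := sub_pos.2 hq1
  rw [gaussTheta_inversion hs]
  gcongr
  refine (gaussTheta_le (by positivity)).trans ?_
  gcongr

lemma sqrt_pi_div_sq_mul {k : ℝ} (hk : 0 < k) (s : ℝ) : √(π / (k ^ 2 * s)) = √(π / s) / k := by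
  rw [mul_comm, ← div_div, sqrt_div' _ (by positivity), sqrt_sq hk.le]

end Theta

section ExtremeStretch

lemma quotients_le_profile {k l : ℝ} (hk : 1 < k) (hl : l < 1) (x : ℝ) :
    (rexp (-(1 * x)) - rexp (-(k * x))) / (k - 1)
      - (rexp (-(l * 2 * x)) - rexp (-(2 * x))) / (1 - l) ≤ profile x := by
  have hfirst : (rexp (-(1 * x)) - rexp (-(k * x))) / (k - 1) ≤ x * rexp (-x) := by
    rw [div_le_iff₀' (by linarith)]
    simpa using exp_neg_mul_sub_exp_neg_mul_le 1 k x
  have hsecond : 2 * x * rexp (-(2 * x))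
      ≤ (rexp (-(l * 2 * x)) - rexp (-(2 * x))) / (1 - l) := by
    rw [le_div_iff₀ (by linarith)]
    linarith [exp_neg_mul_sub_exp_neg_mul_le 2 (l * 2) x]
  unfold profile
  linarith

lemma gaussTheta_quotients_le_tsum_profile {k l t : ℝ} (hk : 1 < k) (hl0 : 0 < l) (hl : l < 1)
    (ht : 0 < t) (hs : Summable fun n : ℤ ↦ profile (t * (n : ℝ) ^ 2)) :
    (gaussTheta t - gaussTheta (k * t)) / (k - 1)
        - (gaussTheta (l * (2 * t)) - gaussTheta (2 * t)) / (1 - l)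
      ≤ ∑' n : ℤ, profile (t * (n : ℝ) ^ 2) := by
  have htheta {a : ℝ} (ha : 0 < a) :
      HasSum (fun n : ℤ ↦ rexp (-(a * (t * (n : ℝ) ^ 2)))) (gaussTheta (a * t)) := by
    simpa only [gaussTheta, mul_assoc] using (summable_exp_neg_mul_sq (mul_pos ha ht)).hasSum
  have hlower := (((htheta one_pos).sub (htheta (by linarith : 0 < k))).div_const (k - 1)).sub
    (((htheta (by positivity : 0 < l * 2)).sub (htheta two_pos)).div_const (1 - l))
  rw [one_mul, mul_assoc l 2 t] at hlower
  exact hasSum_le (fun n : ℤ ↦ quotients_le_profile hk hl (t * (n : ℝ) ^ 2)) hlower hs.hasSum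

lemma lt_tsum_profile_mul_sq {t : ℝ} (ht : 0 < t) (ht' : t ≤ 1)
    (hs : Summable fun n : ℤ ↦ profile (t * (n : ℝ) ^ 2)) :
    0.04 < ∑' n : ℤ, profile (t * (n : ℝ) ^ 2) := by
  -- The steps `1.05²` and `1.11⁻²` balance the error of the difference quotients against that of
  -- approximating `gaussTheta s` by `√(π / s)`.
  refine lt_of_lt_of_le ?_ (gaussTheta_quotients_le_tsum_profile (k := 1.05 ^ 2)
    (l := (1 / 1.11) ^ 2) (by norm_num) (by norm_num) (by norm_num) ht hs)
  have hpi := pi_gt_d2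
  have hθ₁ : √(π / t) ≤ gaussTheta t := sqrt_pi_div_le_gaussTheta ht
  have hθ₂ : √(π / (2 * t)) ≤ gaussTheta (2 * t) := sqrt_pi_div_le_gaussTheta (by positivity)
  have hθ₃ : gaussTheta (1.05 ^ 2 * t) ≤ √(π / t) / 1.05 * 1.0007 := by
    have hq : rexp (-(π ^ 2 / (1.05 ^ 2 * t))) ≤ 0.3679 ^ 8 := by
      refine exp_neg_le_pow ?_
      rw [le_div_iff₀ (by positivity)]
      push_cast
      nlinarith
    rw [← sqrt_pi_div_sq_mul (by norm_num)]
    refine (gaussTheta_le_sqrt_pi_div_mul (by positivity) hq (by norm_num)).trans ?_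
    gcongr
    norm_num
  have hθ₄ : gaussTheta ((1 / 1.11) ^ 2 * (2 * t)) ≤ √(π / (2 * t)) / (1 / 1.11) * 1.005 := by
    have hq : rexp (-(π ^ 2 / ((1 / 1.11) ^ 2 * (2 * t)))) ≤ 0.3679 ^ 6 := by
      refine exp_neg_le_pow ?_
      rw [le_div_iff₀ (by positivity)]
      push_cast
      nlinarith
    rw [← sqrt_pi_div_sq_mul (by norm_num)]
    refine (gaussTheta_le_sqrt_pi_div_mul (by positivity) hq (by norm_num)).trans ?_
    gcongr
    norm_num
  have hsqrt_two : √(π / (2 * t)) ≤ 0.7072 * √(π / t) := by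
    rw [show π / (2 * t) = 1 / 2 * (π / t) by ring, sqrt_mul (by norm_num)]
    gcongr
    exact sqrt_le_iff.2 (by norm_num)
  have hsqrt : 1.77 ≤ √(π / t) := by
    refine le_sqrt_of_sq_le ?_
    rw [le_div_iff₀ ht]
    nlinarith
  norm_num at hθ₃ hθ₄ ⊢
  linarith

variable {u r : ℝ}

lemma summable_profile_div_mul_sq (hu : 0 < u) (hr : 0 < r) :
    Summable fun n : ℤ ↦ profile (u / r * (n : ℝ) ^ 2) := by
  refine ((summable_profile_stretchedForm hu hr).comp_injective
    (Prod.mk_right_injective (0 : ℤ))).congr fun n ↦ ?_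
  rw [Function.comp_apply, stretchedForm_zero_left]
  congr 1
  ring

lemma tsum_profile_div_mul_sq_le_stretchedEnergy (hu : 0 < u) (hr : 0 < r)
    (hur : 1 ≤ 3 / 4 * (u * r)) :
    ∑' n : ℤ, profile (u / r * (n : ℝ) ^ 2) ≤ stretchedEnergy u r := by
  refine (summable_profile_div_mul_sq hu hr).tsum_le_tsum_of_inj (fun n : ℤ ↦ ((0 : ℤ), n))
    (Prod.mk_right_injective 0) (fun p hp ↦ profile_nonneg ?_) (fun n ↦ le_of_eq ?_)
    (summable_profile_stretchedForm hu hr)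
  · have hp1 : p.1 ≠ 0 := fun h ↦ hp ⟨p.2, Prod.ext h.symm rfl⟩
    have hsq : (1 : ℝ) ≤ (p.1 : ℝ) ^ 2 := by
      have : 0 < p.1 ^ 2 := by positivity
      exact_mod_cast this
    calc 1 ≤ 3 / 4 * (u * r) * (p.1 : ℝ) ^ 2 := one_le_mul_of_one_le_of_one_le hur hsq
      _ = u * (3 / 4 * r * (p.1 : ℝ) ^ 2) := by ring
      _ ≤ u * stretchedForm r p := by
        gcongr
        exact le_add_of_nonneg_left (by positivity)
  · rw [stretchedForm_zero_left]
    congr 1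
    ring

lemma stretchedEnergy_one_lt_of_div_le_one (hu : 7 ≤ u) (hr : 1 ≤ r) (hur : u / r ≤ 1) :
    stretchedEnergy u 1 < stretchedEnergy u r := by
  have hu0 : 0 < u := by linarith
  have hr0 : 0 < r := by linarith
  calc stretchedEnergy u 1 ≤ 6.1 * (u * rexp (-u)) := stretchedEnergy_one_le hu
    _ ≤ 0.04 := by linarith [mul_exp_neg_le hu]
    _ < ∑' n : ℤ, profile (u / r * (n : ℝ) ^ 2) :=
      lt_tsum_profile_mul_sq (by positivity) hur (summable_profile_div_mul_sq hu0 hr0)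
    _ ≤ stretchedEnergy u r :=
      tsum_profile_div_mul_sq_le_stretchedEnergy hu0 hr0 (by nlinarith)

end ExtremeStretch

theorem stretchedEnergy_one_lt {u r : ℝ} (hu : 7 ≤ u) (hr : 1 < r) :
    stretchedEnergy u 1 < stretchedEnergy u r := by
  rcases le_total r (7 / 5) with hr' | hr'
  · exact stretchedEnergy_one_lt_of_le hu hr hr'
  rcases le_total 1 (u / r) with hur | hur
  · exact stretchedEnergy_one_lt_of_one_le_div hu hr' hur
  · exact stretchedEnergy_one_lt_of_div_le_one hu hr.le hur

lemma argminOn_eq_singleton {X : Type*} {f : X → ℝ} {s : Set X} {x : X} (hx : x ∈ s)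
    (hlt : ∀ y ∈ s, y ≠ x → f x < f y) : argminOn f s = {x} := by
  refine Set.eq_singleton_iff_unique_mem.2 ⟨⟨hx, fun y hy ↦ ?_⟩, fun y ⟨hy, hmin⟩ ↦ ?_⟩
  · rcases eq_or_ne y x with rfl | hne
    · exact le_refl (f y)
    · exact (hlt y hy hne).le
  · by_contra hne
    exact (hlt y hy hne).not_ge (hmin hx)

lemma coe_hexPoint : (hexPoint : ℂ) = Complex.exp ((π / 3 : ℝ) * Complex.I) := by
  change Complex.exp (Complex.I * (π / 3)) = _
  rw [mul_comm]
  push_cast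
  rfl

lemma hexPoint_re : hexPoint.re = 1 / 2 := by
  rw [← coe_re, coe_hexPoint, Complex.exp_ofReal_mul_I_re, cos_pi_div_three]

lemma hexPoint_im : hexPoint.im = √3 / 2 := by
  rw [← coe_im, coe_hexPoint, Complex.exp_ofReal_mul_I_im, sin_pi_div_three]

lemma im_hexPoint_lt {z : ℍ} (hz : z ∈ gammaC) (hne : z ≠ hexPoint) : hexPoint.im < z.im := by
  refine lt_of_le_of_ne (hexPoint_im.trans_le hz.2) fun him ↦ hne ?_
  exact UpperHalfPlane.ext_re_im (hz.1.trans hexPoint_re.symm) him.symm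

theorem proposition4p3 (α : ℝ) (hα : 2 ≤ α) :
    argminOn (fun z : UpperHalfPlane => latticeK α z - 2 * latticeK (2 * α) z) gammaC
      = {hexPoint} := by
  refine argminOn_eq_singleton ⟨hexPoint_re, hexPoint_im.ge⟩ fun z hz hne ↦ ?_
  have hα0 : 0 < α := by linarith
  have hu : 7 ≤ 2 / √3 * (π * α) := by
    have hsqrt : √3 ≤ 1.75 := sqrt_le_iff.2 (by norm_num)
    rw [div_mul_eq_mul_div, le_div_iff₀ (by positivity)]
    nlinarith [pi_gt_d2]
  have hone : 2 / √3 * hexPoint.im = 1 := by rw [hexPoint_im]; field_simp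
  have hr : 1 < 2 / √3 * z.im := by
    rw [← hone]
    gcongr
    exact im_hexPoint_lt hz hne
  have henergy := stretchedEnergy_one_lt hu hr
  rw [← hone, stretchedEnergy_eq hα0 hexPoint_re, stretchedEnergy_eq hα0 hz.1] at henergy
  exact lt_of_mul_lt_mul_left henergy (by positivity)
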